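/- Let $H^{1/2,2}(\mathbb R)=\{u\in L^2(\mathbb R;\mathbb R) : (-\Delta)^{1/4}u\in L^2(\mathbb R)\}$, with inner product $\langle u,v\rangle_{1/2}=\int_{\mathbb R}(-\Delta)^{1/4}u\,(-\Delta)^{1/4}v\,dx+\int_{\mathbb R}uv\,dx$. Let $P:\mathbb R\to[0,\infty)$ be continuous with $\lim_{|x|\to\infty}P(x)=0$. Let $f:\mathbb R\to[0,\infty)$ be continuous with $f(t)=0$ for all $t\le 0$, and put $F(t)=\int_0^t f(s)\,ds$. Assume - (H2) $f(t)=o(t)$ as $t\to 0$; - (H5) $\displaystyle\lim_{t\to+\infty}\frac{F(t)}{t f(t)}=0$. Then: 1. $f$ belongs to the class $\mathbb C_P$: for every sequence $(u_n)\subset H^{1/2,2}(\mathbb R)$ such that $u_n\rightharpoonup 0$ weakly in $H^{1/2,2}(\mathbb R)$ and, for some constant $C>0$, $\int_{\mathbb R}P(x)f(u_n)u_n\,dx<C$ for all $n$ (the integrals being finite), every $P\,F(u_n)$ is integrable and $\int_{\mathbb R}P(x)F(u_n)\,dx\to 0$. 2. If moreover $f(t)=O(t^2)$ as $t\to0$,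 then for every sequence $(u_n)$ as in 1, every $P\,f(u_n)$ is integrable and $\int_{\mathbb R}P(x)f(u_n)\,dx\to 0$. -/

import Mathlib

open MeasureTheory Filter Topology Asymptotics
open scoped FourierTransform

noncomputable section

namespace HalfSobolev

/-- A real-valued `L²(ℝ)` function, regarded as a complex-valued one. -/
def complexify : Lp ℝ 2 (volume : Measure ℝ) →L[ℝ] Lp ℂ 2 (volume : Measure ℝ) :=
  Complex.ofRealCLM.compLpL 2 volume

theorem ofReal_smul (c : ℝ) (v : Lp ℂ 2 (volume : Measure ℝ)) : (c : ℂ) • v = c • v := by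
  ext1
  filter_upwards [Lp.coeFn_smul (c : ℂ) v, Lp.coeFn_smul c v] with x h1 h2
  simp only [h1, h2, Pi.smul_apply, Complex.real_smul, smul_eq_mul]

/-- The function `ξ ↦ |2πξ|^{1/2} û(ξ)`, that is, the Fourier transform of `(-Δ)^{1/4} u`, where
`û(ξ) = ∫ e^{-2πixξ} u(x) dx` (extended to `L²` by Plancherel). -/
def quarterSymbol (u : Lp ℝ 2 (volume : Measure ℝ)) (ξ : ℝ) : ℂ :=
  ((|2 * Real.pi * ξ| ^ (1 / 2 : ℝ) : ℝ) : ℂ) *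
    ((𝓕 (complexify u) : Lp ℂ 2 (volume : Measure ℝ)) : ℝ → ℂ) ξ

theorem quarterSymbol_add (u v : Lp ℝ 2 (volume : Measure ℝ)) :
    quarterSymbol (u + v) =ᵐ[volume] quarterSymbol u + quarterSymbol v := by
  have h : (𝓕 (complexify (u + v)) : Lp ℂ 2 (volume : Measure ℝ))
      = 𝓕 (complexify u) + 𝓕 (complexify v) := by
    rw [map_add, FourierTransform.fourier_add]
  filter_upwards [Lp.coeFn_add (𝓕 (complexify u)) (𝓕 (complexify v))] with ξ hξ
  simp only [quarterSymbol, h, hξ, Pi.add_apply, mul_add]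

theorem quarterSymbol_smul (c : ℝ) (u : Lp ℝ 2 (volume : Measure ℝ)) :
    quarterSymbol (c • u) =ᵐ[volume] c • quarterSymbol u := by
  have h : (𝓕 (complexify (c • u)) : Lp ℂ 2 (volume : Measure ℝ))
      = (c : ℂ) • 𝓕 (complexify u) := by
    have h1 : complexify (c • u) = (c : ℂ) • complexify u := by
      rw [map_smul, ofReal_smul]
    rw [h1, FourierTransform.fourier_smul]
  filter_upwards [Lp.coeFn_smul (c : ℂ) (𝓕 (complexify u))] with ξ hξ
  simp only [quarterSymbol, h, hξ, Pi.smul_apply, smul_eq_mul, Complex.real_smul]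
  ring

/-- `{u ∈ L²(ℝ) : (-Δ)^{1/4} u ∈ L²(ℝ)}` as a linear subspace of the real space `L²(ℝ)`. -/
def carrier : Submodule ℝ (Lp ℝ 2 (volume : Measure ℝ)) where
  carrier := {u | MemLp (quarterSymbol u) 2 volume}
  zero_mem' := by
    have h := quarterSymbol_smul 0 0
    rw [zero_smul, zero_smul] at h
    exact (memLp_congr_ae h).2 MemLp.zero
  add_mem' {u v} hu hv := (memLp_congr_ae (quarterSymbol_add u v)).2 (hu.add hv)
  smul_mem' c u hu := (memLp_congr_ae (quarterSymbol_smul c u)).2 (hu.const_smul c)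

end HalfSobolev

/-- The real Bessel potential space `H^{1/2,2}(ℝ)`. It is a type of its own, because it carries the
norm `‖·‖_{1/2}` and not the norm of `L²(ℝ)`. -/
def HHalf : Type := HalfSobolev.carrier

namespace HHalf

instance : AddCommGroup HHalf := inferInstanceAs (AddCommGroup HalfSobolev.carrier)

instance : Module ℝ HHalf := inferInstanceAs (Module ℝ HalfSobolev.carrier)

/-- The inclusion of `H^{1/2,2}(ℝ)` into `L²(ℝ)`. -/
def toL2 : HHalf →ₗ[ℝ] Lp ℝ 2 (volume : Measure ℝ) := HalfSobolev.carrier.subtype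

/-- Elements of `H^{1/2,2}(ℝ)` are used as functions on `ℝ`. -/
instance : CoeFun HHalf (fun _ => ℝ → ℝ) := ⟨fun u => (toL2 u : ℝ → ℝ)⟩

theorem memLp_quarterSymbol (u : HHalf) : MemLp (HalfSobolev.quarterSymbol (toL2 u)) 2 volume :=
  Subtype.property (p := fun v => v ∈ HalfSobolev.carrier) u

/-- The operator `(-Δ)^{1/4} : H^{1/2,2}(ℝ) → L²(ℝ)`. -/
def quarterLaplacian : HHalf →ₗ[ℝ] Lp ℂ 2 (volume : Measure ℝ) where
  toFun u := 𝓕⁻ (memLp_quarterSymbol u).toLp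
  map_add' u v := by
    rw [← FourierTransform.fourierInv_add, ← MemLp.toLp_add]
    congr 1
    refine (MemLp.toLp_eq_toLp_iff _ _).2 ?_
    rw [map_add]
    exact HalfSobolev.quarterSymbol_add _ _
  map_smul' c u := by
    rw [RingHom.id_apply, ← HalfSobolev.ofReal_smul, ← FourierTransform.fourierInv_smul,
      HalfSobolev.ofReal_smul, ← MemLp.toLp_const_smul]
    congr 1
    refine (MemLp.toLp_eq_toLp_iff _ _).2 ?_
    rw [map_smul]
    exact HalfSobolev.quarterSymbol_smul _ _

/-- The inner product
`⟨u, v⟩_{1/2} = ∫ (-Δ)^{1/4} u (-Δ)^{1/4} v dx + ∫ u v dx` on `H^{1/2,2}(ℝ)`. -/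
@[reducible]
def innerCore : InnerProductSpace.Core ℝ HHalf where
  inner u v := (inner ℂ (quarterLaplacian u) (quarterLaplacian v)).re +
    inner ℝ (toL2 u) (toL2 v)
  conj_inner_symm u v := by
    simp only [conj_trivial]
    rw [real_inner_comm, ← inner_conj_symm, Complex.conj_re]
  re_inner_nonneg u := by
    simp only [RCLike.re_to_real]
    have h1 : 0 ≤ (inner ℂ (quarterLaplacian u) (quarterLaplacian u)).re :=
      inner_self_nonneg (𝕜 := ℂ) (x := quarterLaplacian u)
    have h2 : 0 ≤ inner ℝ (toL2 u) (toL2 u) := real_inner_self_nonneg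
    exact add_nonneg h1 h2
  add_left u v w := by
    simp only [map_add, inner_add_left, Complex.add_re]
    ring
  smul_left u v c := by
    simp only [map_smul, conj_trivial]
    rw [← HalfSobolev.ofReal_smul, inner_smul_left, real_inner_smul_left, Complex.conj_ofReal,
      Complex.re_ofReal_mul]
    ring
  definite u h := by
    have h1 : 0 ≤ (inner ℂ (quarterLaplacian u) (quarterLaplacian u)).re :=
      inner_self_nonneg (𝕜 := ℂ) (x := quarterLaplacian u)
    have h2 : 0 ≤ inner ℝ (toL2 u) (toL2 u) := real_inner_self_nonneg
    have h3 : inner ℝ (toL2 u) (toL2 u) = 0 := by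
      have h' : (inner ℂ (quarterLaplacian u) (quarterLaplacian u)).re +
        inner ℝ (toL2 u) (toL2 u) = 0 := h
      linarith
    exact Subtype.ext (inner_self_eq_zero.1 h3)

instance : NormedAddCommGroup HHalf := innerCore.toNormedAddCommGroup

instance : InnerProductSpace ℝ HHalf := InnerProductSpace.ofCore innerCore.toCore

theorem inner_def (u v : HHalf) :
    inner ℝ u v = (inner ℂ (quarterLaplacian u) (quarterLaplacian v)).re +
      inner ℝ (toL2 u) (toL2 v) := rfl

theorem norm_sq_eq (u : HHalf) : ‖u‖ ^ 2 = ‖quarterLaplacian u‖ ^ 2 + ‖toL2 u‖ ^ 2 := by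
  rw [← real_inner_self_eq_norm_sq, inner_def, real_inner_self_eq_norm_sq,
    inner_self_eq_norm_sq_to_K]
  norm_cast

end HHalf

/-- `u_n ⇀ 0` weakly in `H^{1/2,2}(ℝ)`. -/
def WeaklyNull (u : ℕ → HHalf) : Prop :=
  Tendsto (fun n => toWeakSpace ℝ HHalf (u n)) atTop (𝓝 0)

/-- `F(t) = ∫_0^t f(s) ds`. -/
def primitive (f : ℝ → ℝ) (t : ℝ) : ℝ := ∫ s in (0 : ℝ)..t, f s

/-- `∫ P(x) f(u_n) u_n dx < C` for all `n`, with a positive constant `C`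
(the integrals being finite). -/
def BoundedEnergy (P f : ℝ → ℝ) (u : ℕ → HHalf) : Prop :=
  (∀ n, Integrable (fun x => P x * f (u n x) * u n x)) ∧
    ∃ C : ℝ, 0 < C ∧ ∀ n, ∫ x, P x * f (u n x) * u n x < C

/-- `∫ P(x) h(u_n) dx → 0`, the integrals being finite. -/
def WeightedIntegralsVanish (P h : ℝ → ℝ) (u : ℕ → HHalf) : Prop :=
  (∀ n, Integrable (fun x => P x * h (u n x))) ∧
    Tendsto (fun n => ∫ x, P x * h (u n x)) atTop (𝓝 0)

/-- The class `ℂ_P` of nonlinearities. -/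
def ClassC (P f : ℝ → ℝ) : Prop :=
  ∀ u : ℕ → HHalf, WeaklyNull u → BoundedEnergy P f u →
    WeightedIntegralsVanish P (primitive f) u

end

/-! Both conclusions follow from one pointwise estimate: for h = F or h = f and every ε > 0, h(t) ≤
ε t f(t) + C_ε t² (`IsDominated`). After multiplying by P and integrating, the energy bound makes
the first term uniformly small, so it remains to show ∫ P u_n² → 0. For that, P is small off a
compact interval, where boundedness in L² suffices; on the interval u_n → 0 in L²
(`WeaklyNull.tendsto_setIntegral_sq`). This local compactness comes from a frequency cutoff at N.
Frequencies above N carry L² mass at most ‖u‖²/N. The part below N is, at each point x, the pairing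
of the Fourier transform with a fixed L² function, so it tends to 0 pointwise with a uniform bound,
and dominated convergence applies. The delicate point in the estimate for F is that (H5) gives no
information at zeros of f; `primitive_le_add_of_le_of_ne_zero` bridges them. -/

noncomputable section

/-! ### Pointwise domination of F and f -/

/-- If `F(t) ≤ ε t f(t)` wherever `t ≥ M` and `f(t) ≠ 0`, then `F(t) ≤ ε t f(t) + F(M)` for all
`t ≥ M`: the quotient `F(t) / (t f(t))` says nothing at the zeros of `f`. -/
theorem primitive_le_add_of_le_of_ne_zero {f : ℝ → ℝ} (hf_cont : Continuous f)
    (hf_nonneg : ∀ t, 0 ≤ f t) {ε M : ℝ} (hM : 0 ≤ M)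
    (h : ∀ t, M ≤ t → f t ≠ 0 → primitive f t ≤ ε * (t * f t)) :
    ∀ t, M ≤ t → primitive f t ≤ ε * (t * f t) + primitive f M := by
  have hd : ∀ t, HasDerivAt (primitive f) (f t) t := fun t =>
    intervalIntegral.integral_hasDerivAt_right (hf_cont.intervalIntegrable _ _)
      hf_cont.stronglyMeasurable.stronglyMeasurableAtFilter hf_cont.continuousAt
  have hc : Continuous (primitive f) :=
    continuous_iff_continuousAt.2 fun t => (hd t).continuousAt
  have hmono : Monotone (primitive f) := monotone_of_deriv_nonneg
    (fun t => (hd t).differentiableAt) fun t => by rw [(hd t).deriv]; exact hf_nonneg t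
  have hFM : 0 ≤ primitive f M := intervalIntegral.integral_nonneg hM fun t _ => hf_nonneg t
  intro t ht
  by_contra! hlt
  have hft : f t = 0 := by
    by_contra hne
    linarith [h t ht hne]
  rw [hft] at hlt
  simp only [mul_zero, zero_add] at hlt
  -- Let s be the first point of [M, t] where F takes the value F(t). It will be shown that f
  -- vanishes just to the left of s, so that F takes this value earlier.
  set S : Set ℝ := {s | s ∈ Set.Icc M t ∧ primitive f s = primitive f t} with hS
  have hSc : IsClosed S := isClosed_Icc.inter (isClosed_eq hc continuous_const)
  have hSn : S.Nonempty := ⟨t, ⟨ht, le_rfl⟩, rfl⟩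
  have hSb : BddBelow S := ⟨M, fun s hs => hs.1.1⟩
  obtain ⟨⟨hs1, hs2⟩, hs3⟩ := hSc.csInf_mem hSn hSb
  set s := sInf S
  have hMs : M < s := by
    rcases hs1.eq_or_lt with h1 | h1
    · rw [← h1] at hs3; linarith
    · exact h1
  have hfs : f s = 0 := by
    rcases hs2.eq_or_lt with h1 | h1
    · rw [h1, hft]
    -- F is monotone with F(s) = F(t), hence constant on [s, t], and its right derivative at s is 0.
    · have hev : primitive f =ᶠ[𝓝[>] s] fun _ => primitive f s := by
        filter_upwards [Ioo_mem_nhdsGT h1] with r hr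
        exact le_antisymm ((hmono hr.2.le).trans hs3.ge) (hmono hr.1.le)
      have h2 := (hd s).hasDerivWithinAt (s := Set.Ioi s)
      have h3 : HasDerivWithinAt (primitive f) 0 (Set.Ioi s) s :=
        (hasDerivWithinAt_const s (Set.Ioi s) (primitive f s)).congr_of_eventuallyEq hev rfl
      exact (uniqueDiffWithinAt_Ioi s).eq_deriv _ h2 h3
  -- Since f(s) = 0 < F(s), the reverse of the inequality in `h` holds strictly near s; there `h`
  -- can only be vacuous, that is, f = 0.
  have hop : ∀ᶠ r in 𝓝 s, ε * (r * f r) < primitive f r := by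
    refine (IsOpen.mem_nhds (isOpen_lt (by fun_prop) hc) ?_)
    simp only [Set.mem_ofPred_eq, hfs, mul_zero, hs3]
    linarith
  obtain ⟨l, hl, hlr⟩ := exists_Ioc_subset_of_mem_nhds hop ⟨M, hMs⟩
  set m := max l M
  have hms : m < s := max_lt hl hMs
  set r := (m + s) / 2
  have hmr : m < r := by simp only [r]; linarith
  have hrs : r < s := by simp only [r]; linarith
  have hzero : ∀ x ∈ Set.uIcc r s, f x = 0 := by
    intro x hx
    rw [Set.uIcc_of_le hrs.le] at hx
    by_contra hne
    have h1 := h x (((le_max_right l M).trans hmr.le).trans hx.1) hne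
    have h2 : ε * (x * f x) < primitive f x :=
      hlr ⟨(le_max_left l M).trans_lt (hmr.trans_le hx.1), hx.2⟩
    linarith
  have hFr : primitive f r = primitive f s := by
    have h1 : primitive f s - primitive f r = ∫ x in r..s, f x :=
      intervalIntegral.integral_interval_sub_left (hf_cont.intervalIntegrable _ _)
        (hf_cont.intervalIntegrable _ _)
    rw [intervalIntegral.integral_congr (g := fun _ => 0) hzero] at h1
    simp at h1
    linarith
  exact absurd (csInf_le hSb ⟨⟨(le_max_right l M).trans hmr.le, hrs.le.trans hs2⟩, hFr.trans hs3⟩)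
    (not_le.2 hrs)

/-- A continuous function which is `O(t²)` at `0` is bounded by `C t²` on bounded sets. -/
theorem exists_le_mul_sq_of_isBigO {g : ℝ → ℝ} (hg : Continuous g)
    (h0 : g =O[𝓝 0] fun t : ℝ => t ^ 2) (M : ℝ) :
    ∃ C, 0 ≤ C ∧ ∀ t ∈ Set.Icc 0 M, g t ≤ C * t ^ 2 := by
  obtain ⟨c, hc0, hc⟩ := h0.exists_nonneg
  obtain ⟨δ, hδ, hball⟩ := Metric.eventually_nhds_iff.1 hc.bound
  obtain ⟨B, hB⟩ := (isCompact_Icc (a := (0 : ℝ)) (b := M)).exists_bound_of_continuousOn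
    hg.continuousOn
  -- `c` serves for t < δ; for t ≥ δ one has t²/δ² ≥ 1, which absorbs the compactness bound.
  refine ⟨c + |B| / δ ^ 2, by positivity, fun t ht => ?_⟩
  rcases lt_or_ge t δ with h | h
  · have h1 : ‖g t‖ ≤ c * ‖t ^ 2‖ := hball (by
      rw [Real.dist_eq, sub_zero, abs_of_nonneg ht.1]; exact h)
    rw [norm_pow, Real.norm_eq_abs t, sq_abs] at h1
    have h2 : 0 ≤ |B| / δ ^ 2 * t ^ 2 := by positivity
    linarith [Real.le_norm_self (g t)]
  · have h1 : g t ≤ |B| := (Real.le_norm_self _).trans ((hB t ht).trans (le_abs_self B))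
    have h2 : |B| ≤ |B| / δ ^ 2 * t ^ 2 := by
      rw [div_mul_eq_mul_div, le_div_iff₀ (by positivity)]
      gcongr
    nlinarith [mul_nonneg hc0 (sq_nonneg t)]

/-- `h` is controlled by an arbitrarily small multiple of `t f(t)`, up to a multiple of `t²`. -/
def IsDominated (f h : ℝ → ℝ) : Prop :=
  ∀ ε > 0, ∃ C, 0 ≤ C ∧ ∀ t, h t ≤ ε * (t * f t) + C * t ^ 2

theorem continuous_primitive {f : ℝ → ℝ} (hf_cont : Continuous f) : Continuous (primitive f) :=
  intervalIntegral.continuous_primitive (fun _ _ => hf_cont.intervalIntegrable _ _) 0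

theorem primitive_of_nonpos {f : ℝ → ℝ} (hf_neg : ∀ t ≤ 0, f t = 0) {t : ℝ} (ht : t ≤ 0) :
    primitive f t = 0 := by
  rw [primitive, intervalIntegral.integral_congr (g := fun _ => 0), intervalIntegral.integral_zero]
  intro s hs
  rw [Set.uIcc_of_ge ht] at hs
  exact hf_neg s hs.2

theorem primitive_nonneg {f : ℝ → ℝ} (hf_nonneg : ∀ t, 0 ≤ f t) (hf_neg : ∀ t ≤ 0, f t = 0)
    (t : ℝ) : 0 ≤ primitive f t := by
  rcases le_total t 0 with ht | ht
  · exact (primitive_of_nonpos hf_neg ht).ge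
  · exact intervalIntegral.integral_nonneg ht fun t _ => hf_nonneg t

theorem primitive_isBigO {f : ℝ → ℝ} (H2 : f =o[𝓝 0] (fun t : ℝ => t)) :
    primitive f =O[𝓝 0] fun t : ℝ => t ^ 2 := by
  obtain ⟨δ, hδ, hball⟩ := Metric.eventually_nhds_iff.1 (H2.bound one_pos)
  refine IsBigO.of_bound 1 (Metric.eventually_nhds_iff.2 ⟨δ, hδ, fun t ht => ?_⟩)
  rw [Real.dist_eq, sub_zero] at ht
  refine (intervalIntegral.norm_integral_le_of_norm_le_const (C := |t|) fun s hs => ?_).trans ?_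
  · have hst : |s| ≤ |t| := by
      simpa using Set.abs_sub_left_of_mem_uIcc (Set.uIoc_subset_uIcc hs)
    have h1 : ‖f s‖ ≤ 1 * ‖s‖ := hball (by rw [Real.dist_eq, sub_zero]; exact hst.trans_lt ht)
    rw [one_mul, Real.norm_eq_abs s] at h1
    exact h1.trans hst
  · rw [sub_zero, norm_pow, Real.norm_eq_abs, one_mul, sq]

theorem isDominated_primitive {f : ℝ → ℝ} (hf_cont : Continuous f) (hf_nonneg : ∀ t, 0 ≤ f t)
    (hf_neg : ∀ t ≤ 0, f t = 0) (H2 : f =o[𝓝 0] (fun t : ℝ => t))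
    (H5 : Tendsto (fun t => primitive f t / (t * f t)) atTop (𝓝 0)) :
    IsDominated f (primitive f) := by
  intro ε hε
  obtain ⟨M₀, hM₀⟩ := eventually_atTop.1 (H5.eventually (gt_mem_nhds hε))
  -- M ≥ 1 lets the constant F(M) be absorbed into F(M) t² for t ≥ M.
  set M := max M₀ 1
  have hM1 : 1 ≤ M := le_max_right _ _
  have hM : 0 ≤ M := by linarith
  have hlarge := primitive_le_add_of_le_of_ne_zero hf_cont hf_nonneg hM
    fun t ht hne => by
      have hpos : 0 < t * f t :=
        mul_pos (by linarith) (lt_of_le_of_ne (hf_nonneg t) (Ne.symm hne))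
      exact ((div_lt_iff₀ hpos).1 (hM₀ t ((le_max_left _ _).trans ht))).le
  obtain ⟨C, hC, hsmall⟩ := exists_le_mul_sq_of_isBigO (continuous_primitive hf_cont)
    (primitive_isBigO H2) M
  have hFM := primitive_nonneg hf_nonneg hf_neg M
  refine ⟨C + primitive f M, by positivity, fun t => ?_⟩
  have hsq := sq_nonneg t
  rcases le_or_gt t 0 with ht | ht
  · rw [primitive_of_nonpos hf_neg ht, hf_neg t ht]
    nlinarith
  have htf : 0 ≤ ε * (t * f t) := mul_nonneg hε.le (mul_nonneg ht.le (hf_nonneg t))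
  rcases le_total t M with h | h
  · nlinarith [hsmall t ⟨ht.le, h⟩]
  · have h1 : 1 ≤ t ^ 2 := one_le_pow₀ (hM1.trans h)
    nlinarith [hlarge t h]

/-- Beyond t = 1/ε one has f(t) ≤ ε t f(t); below it the t² bound applies. -/
theorem isDominated_self {f : ℝ → ℝ} (hf_cont : Continuous f) (hf_nonneg : ∀ t, 0 ≤ f t)
    (hf_neg : ∀ t ≤ 0, f t = 0) (h0 : f =O[𝓝 0] (fun t : ℝ => t ^ 2)) : IsDominated f f := by
  intro ε hε
  obtain ⟨C, hC, hsmall⟩ := exists_le_mul_sq_of_isBigO hf_cont h0 ε⁻¹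
  refine ⟨C, hC, fun t => ?_⟩
  have hsq : 0 ≤ C * t ^ 2 := by positivity
  rcases le_or_gt t 0 with ht | ht
  · rw [hf_neg t ht]; simpa using hsq
  have htf : 0 ≤ ε * (t * f t) := mul_nonneg hε.le (mul_nonneg ht.le (hf_nonneg t))
  rcases le_total t ε⁻¹ with h | h
  · linarith [hsmall t ⟨ht.le, h⟩]
  · have h1 : 1 ≤ ε * t := by
      rw [inv_le_iff_one_le_mul₀' hε] at h; exact h
    nlinarith [hf_nonneg t]

/-! ### Fourier transform on L² and weak convergence -/

/-- On `L¹ ∩ L²` the `L²` inverse Fourier transform is given by the integral. -/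
theorem fourierInv_toLp_ae_eq {g : ℝ → ℂ} (h1 : Integrable g) (h2 : MemLp g 2 volume) :
    ((𝓕⁻ h2.toLp : Lp ℂ 2 (volume : Measure ℝ)) : ℝ → ℂ) =ᵐ[volume] 𝓕⁻ g := by
  have hcont : Continuous (𝓕⁻ g) := by
    have h : Continuous (𝓕 g) := VectorFourier.fourierIntegral_continuous
      Real.continuous_fourierChar continuous_inner h1
    have h' : 𝓕⁻ g = fun x => 𝓕 g (-x) := funext fun x => Real.fourierInv_eq_fourier_neg g x
    rw [h']
    exact h.comp continuous_neg
  refine ae_eq_of_integral_contDiff_smul_eq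
    ((Lp.memLp _).locallyIntegrable one_le_two) hcont.locallyIntegrable fun φ hφ hφc => ?_
  -- Both sides are tested against φ and the transform is moved onto φ: by the tempered-distribution
  -- definition on the L² side, by Fubini on the L¹ side.
  have hψc : HasCompactSupport (Complex.ofRealCLM ∘ φ) := hφc.comp_left rfl
  have hψ : ContDiff ℝ (⊤ : ℕ∞) (Complex.ofRealCLM ∘ φ) := by fun_prop
  set ψ : SchwartzMap ℝ ℂ := hψc.toSchwartzMap hψ
  have hψφ : ∀ x, ψ x = (φ x : ℂ) := fun x => rfl
  calc ∫ x, φ x • ((𝓕⁻ h2.toLp : Lp ℂ 2 (volume : Measure ℝ)) : ℝ → ℂ) x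
      = Lp.toTemperedDistribution (𝓕⁻ h2.toLp : Lp ℂ 2 (volume : Measure ℝ)) ψ := by
        rw [Lp.toTemperedDistribution_apply]; simp [hψφ]
    _ = Lp.toTemperedDistribution (h2.toLp : Lp ℂ 2 (volume : Measure ℝ)) (𝓕⁻ ψ) := by
        rw [← Lp.fourierInv_toTemperedDistribution_eq]; rfl
    _ = ∫ x, (𝓕⁻ (ψ : ℝ → ℂ)) x • g x := by
        rw [Lp.toTemperedDistribution_apply, SchwartzMap.fourierInv_coe]
        refine integral_congr_ae ?_
        filter_upwards [h2.coeFn_toLp] with x hx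
        rw [hx]
    _ = ∫ x, ψ x • 𝓕⁻ g x := by
        -- `𝓕⁻` is the Fourier integral for the symmetric form `-innerₗ ℝ`.
        have hL : Continuous fun p : ℝ × ℝ => (-innerₗ ℝ) p.1 p.2 := by
          simp only [LinearMap.neg_apply, innerₗ_apply_apply]
          fun_prop
        have h := VectorFourier.integral_fourierIntegral_smul_eq_flip (L := -innerₗ ℝ)
          (μ := volume) (ν := volume) Real.continuous_fourierChar hL ψ.integrable h1
        have hflip : (-innerₗ ℝ).flip = -innerₗ ℝ := by
          ext; simp
        rw [hflip] at h
        exact h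
    _ = ∫ x, φ x • 𝓕⁻ g x := by simp [hψφ]

theorem L2_norm_sq_eq_integral {𝕜 : Type*} [RCLike 𝕜] (v : Lp 𝕜 2 (volume : Measure ℝ)) :
    ‖v‖ ^ 2 = ∫ x, ‖v x‖ ^ 2 := by
  have h : inner 𝕜 v v = ((‖v‖ : 𝕜)) ^ 2 := inner_self_eq_norm_sq_to_K v
  rw [L2.inner_def] at h
  have h' : ∀ x, inner 𝕜 (v x) (v x) = ((‖v x‖ ^ 2 : ℝ) : 𝕜) := fun x => by
    rw [inner_self_eq_norm_sq_to_K]; push_cast; rfl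
  simp_rw [h'] at h
  rw [integral_ofReal] at h
  exact_mod_cast h.symm

namespace HHalf

/-- The Fourier transform of an element of `H^{1/2,2}(ℝ)`. -/
def fourier (u : HHalf) : Lp ℂ 2 (volume : Measure ℝ) := 𝓕 (HalfSobolev.complexify (toL2 u))

theorem norm_complexify (v : Lp ℝ 2 (volume : Measure ℝ)) : ‖HalfSobolev.complexify v‖ = ‖v‖ := by
  refine (sq_eq_sq₀ (norm_nonneg _) (norm_nonneg _)).1 ?_
  rw [L2_norm_sq_eq_integral, L2_norm_sq_eq_integral]
  refine integral_congr_ae ?_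
  filter_upwards [Complex.ofRealCLM.coeFn_compLp v] with x hx
  have hx' : HalfSobolev.complexify v x = (v x : ℂ) := hx
  rw [hx', Complex.norm_real]

theorem norm_toL2_le (u : HHalf) : ‖toL2 u‖ ≤ ‖u‖ :=
  abs_le_of_sq_le_sq' (by rw [norm_sq_eq]; nlinarith [sq_nonneg ‖quarterLaplacian u‖])
    (norm_nonneg _) |>.2

theorem norm_quarterLaplacian_le (u : HHalf) : ‖quarterLaplacian u‖ ≤ ‖u‖ :=
  abs_le_of_sq_le_sq' (by rw [norm_sq_eq]; nlinarith [sq_nonneg ‖toL2 u‖])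
    (norm_nonneg _) |>.2

theorem norm_fourier_le (u : HHalf) : ‖fourier u‖ ≤ ‖u‖ := by
  rw [fourier, Lp.norm_fourier_eq, norm_complexify]
  exact norm_toL2_le u

/-- The Fourier transform as a bounded real-linear map. -/
def fourierCLM : HHalf →L[ℝ] Lp ℂ 2 (volume : Measure ℝ) :=
  LinearMap.mkContinuous
    { toFun := fourier
      map_add' := fun u v => by
        simp only [fourier, map_add, FourierTransform.fourier_add]
      map_smul' := fun c u => by
        simp only [fourier, map_smul, RingHom.id_apply]
        rw [← HalfSobolev.ofReal_smul, FourierTransform.fourier_smul, HalfSobolev.ofReal_smul] }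
    1 fun u => by rw [one_mul]; exact norm_fourier_le u

theorem integral_norm_quarterSymbol_sq_le (u : HHalf) :
    ∫ ξ, ‖HalfSobolev.quarterSymbol (toL2 u) ξ‖ ^ 2 ≤ ‖u‖ ^ 2 := by
  have h1 : ‖quarterLaplacian u‖ = ‖(memLp_quarterSymbol u).toLp‖ :=
    (Lp.fourierTransformₗᵢ ℝ ℂ).symm.norm_map _
  have h2 : ‖(memLp_quarterSymbol u).toLp‖ ^ 2
      = ∫ ξ, ‖HalfSobolev.quarterSymbol (toL2 u) ξ‖ ^ 2 := by
    rw [L2_norm_sq_eq_integral]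
    refine integral_congr_ae ?_
    filter_upwards [(memLp_quarterSymbol u).coeFn_toLp] with x hx
    rw [hx]
  rw [← h2, ← h1]
  gcongr
  exact norm_quarterLaplacian_le u

end HHalf

namespace WeaklyNull

theorem tendsto_apply {u : ℕ → HHalf} (hu : WeaklyNull u) (φ : HHalf →L[ℝ] ℝ) :
    Tendsto (fun n => φ (u n)) atTop (𝓝 0) := by
  have h := ((WeakBilin.eval_continuous (topDualPairing ℝ HHalf).flip φ).tendsto 0).comp hu
  have h0 : Tendsto (fun n => φ (u n)) atTop (𝓝 (φ 0)) := h
  rwa [map_zero] at h0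

/-- Uniform boundedness is applied in the bidual, to functionals on the complete space dual to
`HHalf`; completeness of `HHalf` itself is not needed. -/
theorem exists_norm_le {u : ℕ → HHalf} (hu : WeaklyNull u) : ∃ B, 0 ≤ B ∧ ∀ n, ‖u n‖ ≤ B := by
  obtain ⟨B, hB⟩ := banach_steinhaus
    (g := fun n => NormedSpace.inclusionInDoubleDual ℝ HHalf (u n)) fun φ => by
      obtain ⟨C, hC⟩ := (hu.tendsto_apply φ).norm.bddAbove_range
      exact ⟨C, fun n => hC ⟨n, rfl⟩⟩
  have h : ∀ n, ‖u n‖ ≤ B := fun n => by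
    rw [← (NormedSpace.inclusionInDoubleDualLi ℝ (E := HHalf)).norm_map (u n)]; exact hB n
  exact ⟨B, (norm_nonneg _).trans (h 0), h⟩

theorem tendsto_inner_fourier {u : ℕ → HHalf} (hu : WeaklyNull u)
    (g : Lp ℂ 2 (volume : Measure ℝ)) :
    Tendsto (fun n => inner ℂ g (HHalf.fourier (u n))) atTop (𝓝 0) := by
  set L : HHalf →L[ℝ] ℂ := ((innerSL ℂ g).restrictScalars ℝ).comp HHalf.fourierCLM
  -- Weak convergence is tested by real functionals, so the two parts of the complex pairing are
  -- treated separately.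
  have hre := hu.tendsto_apply (Complex.reCLM.comp L)
  have him := hu.tendsto_apply (Complex.imCLM.comp L)
  have h := ((Complex.continuous_ofReal.tendsto 0).comp hre).add
    (((Complex.continuous_ofReal.tendsto 0).comp him).mul_const Complex.I)
  simp only [Complex.ofReal_zero, zero_mul, add_zero] at h
  exact h.congr fun n => Complex.re_add_im (L (u n))

end WeaklyNull

/-! ### Frequency splitting and local compactness -/

/-- The restriction of an `L²` function to the frequencies `|ξ| ≤ N`. -/
def lowFrequencies (N : ℝ) (U : Lp ℂ 2 (volume : Measure ℝ)) : ℝ → ℂ :=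
  (Set.Icc (-N) N).indicator U

theorem memLp_lowFrequencies (N : ℝ) (U : Lp ℂ 2 (volume : Measure ℝ)) :
    MemLp (lowFrequencies N U) 2 volume := (Lp.memLp U).indicator measurableSet_Icc

theorem integrable_lowFrequencies (N : ℝ) (U : Lp ℂ 2 (volume : Measure ℝ)) :
    Integrable (lowFrequencies N U) := by
  rw [lowFrequencies, integrable_indicator_iff measurableSet_Icc]
  exact ((Lp.memLp U).restrict _).integrable one_le_two

/-- The representing function is the conjugate character cut off to [-N, N]. Its norm is bounded
independently of x, which supplies the dominating constant later. -/
theorem exists_fourierInv_lowFrequencies_eq_inner (N x : ℝ) :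
    ∃ e : Lp ℂ 2 (volume : Measure ℝ), ‖e‖ ^ 2 ≤ 2 * |N| ∧
      ∀ U, 𝓕⁻ (lowFrequencies N U) x = inner ℂ e U := by
  set k : ℝ → ℂ := fun v => (starRingEnd ℂ) (Real.fourierChar (v * x) : ℂ)
  have hkc : Continuous k := by
    refine Complex.continuous_conj.comp (continuous_subtype_val.comp
      (Real.continuous_fourierChar.comp ?_))
    fun_prop
  have hk1 : ∀ v, ‖k v‖ = 1 := fun v => by
    rw [RCLike.norm_conj, Circle.norm_coe]
  have hk : MemLp ((Set.Icc (-N) N).indicator k) 2 volume := by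
    rw [memLp_indicator_iff_restrict measurableSet_Icc]
    exact MemLp.of_bound hkc.aestronglyMeasurable 1 (.of_forall fun v => (hk1 v).le)
  refine ⟨hk.toLp, ?_, fun U => ?_⟩
  · rw [L2_norm_sq_eq_integral]
    calc ∫ v, ‖hk.toLp _ v‖ ^ 2 = ∫ v, (Set.Icc (-N) N).indicator (fun _ => (1 : ℝ)) v := by
          refine integral_congr_ae ?_
          filter_upwards [hk.coeFn_toLp] with v hv
          rw [hv]
          by_cases h : v ∈ Set.Icc (-N) N <;> simp [h, hk1]
      _ ≤ 2 * |N| := by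
          rw [integral_indicator measurableSet_Icc]
          simp only [integral_const, smul_eq_mul, mul_one, measureReal_restrict_apply_univ,
            Real.volume_real_Icc]
          refine max_le ?_ (by positivity)
          linarith [le_abs_self N]
  · rw [L2.inner_def, Real.fourierInv_eq]
    refine integral_congr_ae ?_
    filter_upwards [hk.coeFn_toLp] with v hv
    rw [hv]
    by_cases h : v ∈ Set.Icc (-N) N
    · simp only [lowFrequencies, Set.indicator_of_mem h, k, RCLike.inner_apply, Circle.smul_def,
        Complex.conj_conj, smul_eq_mul, conj_trivial]
      rw [mul_comm x v, mul_comm]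
    · simp [lowFrequencies, h]

theorem continuous_fourierInv_lowFrequencies (N : ℝ) (U : Lp ℂ 2 (volume : Measure ℝ)) :
    Continuous (𝓕⁻ (lowFrequencies N U)) := by
  have h : Continuous (𝓕 (lowFrequencies N U)) := VectorFourier.fourierIntegral_continuous
    Real.continuous_fourierChar continuous_inner (integrable_lowFrequencies N U)
  have h' : 𝓕⁻ (lowFrequencies N U) = fun x => 𝓕 (lowFrequencies N U) (-x) :=
    funext fun x => Real.fourierInv_eq_fourier_neg _ x
  rw [h']
  exact h.comp continuous_neg

theorem WeaklyNull.tendsto_integral_lowFrequencies {u : ℕ → HHalf} (hu : WeaklyNull u) (N R : ℝ) :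
    Tendsto (fun n => ∫ x in Set.Icc (-R) R,
      ‖𝓕⁻ (lowFrequencies N (HHalf.fourier (u n))) x‖ ^ 2) atTop (𝓝 0) := by
  obtain ⟨B, hB0, hB⟩ := hu.exists_norm_le
  choose e he heq using exists_fourierInv_lowFrequencies_eq_inner N
  have h := tendsto_integral_of_dominated_convergence
    (μ := volume.restrict (Set.Icc (-R) R)) (f := fun _ => (0 : ℝ))
    (F := fun n x => ‖𝓕⁻ (lowFrequencies N (HHalf.fourier (u n))) x‖ ^ 2)
    (fun _ => 2 * |N| * B ^ 2)
    (fun n => ((continuous_fourierInv_lowFrequencies N _).norm.pow 2).aestronglyMeasurable)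
    (integrable_const _)
    (fun n => .of_forall fun x => by
      rw [Real.norm_of_nonneg (by positivity), heq]
      calc ‖inner ℂ (e x) (HHalf.fourier (u n))‖ ^ 2
          ≤ (‖e x‖ * ‖HHalf.fourier (u n)‖) ^ 2 := by gcongr; exact norm_inner_le_norm _ _
        _ = ‖e x‖ ^ 2 * ‖HHalf.fourier (u n)‖ ^ 2 := mul_pow _ _ _
        _ ≤ 2 * |N| * B ^ 2 := by
          gcongr
          · exact he x
          · exact (HHalf.norm_fourier_le _).trans (hB n))
    (.of_forall fun x => by
      simp_rw [heq]
      simpa using ((hu.tendsto_inner_fourier (e x)).norm.pow 2))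
  simpa using h

namespace HHalf

/-- Where |ξ| > N, the weight |2πξ| in the squared symbol is at least N. -/
theorem integral_highFrequencies_le (u : HHalf) {N : ℝ} (hN : 0 < N) :
    ∫ ξ, ‖fourier u ξ - lowFrequencies N (fourier u) ξ‖ ^ 2 ≤ ‖u‖ ^ 2 / N := by
  rw [le_div_iff₀' hN, ← integral_const_mul]
  refine le_trans (integral_mono_of_nonneg (.of_forall fun ξ => by positivity)
    ((memLp_two_iff_integrable_sq_norm (memLp_quarterSymbol u).1).1 (memLp_quarterSymbol u))
    (.of_forall fun ξ => ?_)) (integral_norm_quarterSymbol_sq_le u)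
  have hsq : ‖HalfSobolev.quarterSymbol (toL2 u) ξ‖ ^ 2
      = |2 * Real.pi * ξ| * ‖fourier u ξ‖ ^ 2 := by
    rw [HalfSobolev.quarterSymbol, norm_mul, mul_pow, Complex.norm_real, Real.norm_eq_abs, sq_abs,
      ← Real.rpow_natCast, ← Real.rpow_mul (abs_nonneg _)]
    norm_num
    exact Or.inl rfl
  simp only [hsq]
  by_cases h : ξ ∈ Set.Icc (-N) N
  · simp only [lowFrequencies, Set.indicator_of_mem h, sub_self, norm_zero]
    have : 0 ≤ |2 * Real.pi * ξ| * ‖fourier u ξ‖ ^ 2 := by positivity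
    simpa using this
  · simp only [lowFrequencies, Set.indicator_of_notMem h, sub_zero]
    have h1 : N ≤ |ξ| := by
      rw [Set.mem_Icc, ← abs_le, not_le] at h
      exact h.le
    have h2 : N ≤ |2 * Real.pi * ξ| := by
      rw [abs_mul, abs_of_pos Real.two_pi_pos]
      nlinarith [Real.pi_gt_three, abs_nonneg ξ]
    gcongr

/-- Split u into low and high frequencies and use (a + b)² ≤ 2a² + 2b²; Plancherel on the whole line
bounds the high part. -/
theorem setIntegral_sq_le (u : HHalf) {N : ℝ} (hN : 0 < N) (R : ℝ) :
    ∫ x in Set.Icc (-R) R, (u x) ^ 2 ≤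
      2 * (∫ x in Set.Icc (-R) R, ‖𝓕⁻ (lowFrequencies N (fourier u)) x‖ ^ 2)
        + 2 * (‖u‖ ^ 2 / N) := by
  set U := fourier u
  set a : ℝ → ℂ := 𝓕⁻ (lowFrequencies N U)
  set lo : Lp ℂ 2 (volume : Measure ℝ) := (memLp_lowFrequencies N U).toLp
  set b : Lp ℂ 2 (volume : Measure ℝ) := 𝓕⁻ (U - lo)
  have hb : ∫ x, ‖b x‖ ^ 2 ≤ ‖u‖ ^ 2 / N := by
    have h1 : ‖b‖ = ‖U - lo‖ := (Lp.fourierTransformₗᵢ ℝ ℂ).symm.norm_map _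
    rw [← L2_norm_sq_eq_integral, h1, L2_norm_sq_eq_integral]
    refine le_trans (integral_congr_ae ?_).le (integral_highFrequencies_le u hN)
    filter_upwards [Lp.coeFn_sub U lo, (memLp_lowFrequencies N U).coeFn_toLp] with ξ h2 h3
    rw [h2, Pi.sub_apply, h3]
  have hdec : HalfSobolev.complexify (toL2 u) = 𝓕⁻ lo + b := by
    rw [← FourierTransform.fourierInv_add, add_sub_cancel]
    exact (FourierTransform.fourierInv_fourier_eq _).symm
  have hae : ∀ᵐ x, (u x : ℂ) = a x + b x := by
    have h0 : (HalfSobolev.complexify (toL2 u) : ℝ → ℂ) =ᵐ[volume] fun x => (u x : ℂ) :=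
      Complex.ofRealCLM.coeFn_compLp (toL2 u)
    rw [hdec] at h0
    filter_upwards [h0, Lp.coeFn_add (𝓕⁻ lo) b, fourierInv_toLp_ae_eq
      (integrable_lowFrequencies N U) (memLp_lowFrequencies N U)] with x h1 h2 h3
    rw [← h1, h2, Pi.add_apply, h3]
  have hai : IntegrableOn (fun x => ‖a x‖ ^ 2) (Set.Icc (-R) R) :=
    ((continuous_fourierInv_lowFrequencies N U).norm.pow 2).integrableOn_Icc
  have hbi : Integrable (fun x => ‖b x‖ ^ 2) :=
    (memLp_two_iff_integrable_sq_norm (Lp.memLp b).1).1 (Lp.memLp b)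
  calc ∫ x in Set.Icc (-R) R, (u x) ^ 2
      ≤ ∫ x in Set.Icc (-R) R, (2 * ‖a x‖ ^ 2 + 2 * ‖b x‖ ^ 2) := by
        refine integral_mono_of_nonneg (.of_forall fun x => sq_nonneg _)
          ((hai.const_mul 2).add (hbi.integrableOn.const_mul 2)) ?_
        filter_upwards [ae_restrict_of_ae hae] with x hx
        have h1 : |u x| ≤ ‖a x‖ + ‖b x‖ := by
          rw [← Real.norm_eq_abs, ← Complex.norm_real, hx]
          exact norm_add_le _ _
        rw [← sq_abs]
        nlinarith [abs_nonneg (u x), sq_nonneg (‖a x‖ - ‖b x‖)]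
    _ = 2 * (∫ x in Set.Icc (-R) R, ‖a x‖ ^ 2) + 2 * ∫ x in Set.Icc (-R) R, ‖b x‖ ^ 2 := by
        rw [integral_add (hai.const_mul 2) (hbi.integrableOn.const_mul 2), integral_const_mul,
          integral_const_mul]
    _ ≤ _ := by
        gcongr
        exact (setIntegral_le_integral hbi (.of_forall fun x => sq_nonneg _)).trans hb

theorem integrable_sq (u : HHalf) : Integrable (fun x => (u x) ^ 2) :=
  (memLp_two_iff_integrable_sq (Lp.memLp (toL2 u)).1).1 (Lp.memLp (toL2 u))

theorem integral_sq_le (u : HHalf) : ∫ x, (u x) ^ 2 ≤ ‖u‖ ^ 2 := by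
  have h := L2_norm_sq_eq_integral (toL2 u)
  simp only [Real.norm_eq_abs, sq_abs] at h
  rw [← h]
  gcongr
  exact norm_toL2_le u

end HHalf

/-- The local Rellich theorem for weakly null sequences. -/
theorem WeaklyNull.tendsto_setIntegral_sq {u : ℕ → HHalf} (hu : WeaklyNull u) (R : ℝ) :
    Tendsto (fun n => ∫ x in Set.Icc (-R) R, (u n x) ^ 2) atTop (𝓝 0) := by
  obtain ⟨B, hB0, hB⟩ := hu.exists_norm_le
  refine Metric.tendsto_nhds.2 fun ε hε => ?_
  -- The high frequencies then cost at most ε/2; the +1 keeps N positive when B = 0.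
  set N := 4 * (B ^ 2 + 1) / ε
  have hN : 0 < N := by positivity
  have hBN : 2 * (B ^ 2 / N) ≤ ε / 2 := by
    have : N * ε = 4 * (B ^ 2 + 1) := div_mul_cancel₀ _ hε.ne'
    rw [← mul_div_assoc, div_le_iff₀ hN]
    nlinarith
  filter_upwards [(hu.tendsto_integral_lowFrequencies N R).eventually
    (gt_mem_nhds (show (0 : ℝ) < ε / 4 by linarith))] with n hn
  have h0 : 0 ≤ ∫ x in Set.Icc (-R) R, (u n x) ^ 2 := integral_nonneg fun x => sq_nonneg _
  rw [Real.dist_eq, sub_zero, abs_of_nonneg h0]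
  have h1 := (u n).setIntegral_sq_le hN R
  have h2 : ‖u n‖ ^ 2 / N ≤ B ^ 2 / N := by gcongr; exact hB n
  linarith

/-! ### Weighted integrals and conclusion -/

theorem exists_forall_le_of_tendsto_cocompact {P : ℝ → ℝ} (hP_cont : Continuous P)
    (hP_lim : Tendsto P (cocompact ℝ) (𝓝 0)) : ∃ K, 0 ≤ K ∧ ∀ x, P x ≤ K := by
  obtain ⟨S, hS, hSP⟩ := mem_cocompact.1 (hP_lim.eventually (gt_mem_nhds one_pos))
  obtain ⟨K, hK⟩ := hS.exists_bound_of_continuousOn hP_cont.continuousOn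
  refine ⟨max K 1, by positivity, fun x => ?_⟩
  by_cases hx : x ∈ S
  · exact ((Real.le_norm_self _).trans (hK x hx)).trans (le_max_left _ _)
  · exact (le_of_lt (hSP hx)).trans (le_max_right _ _)

theorem integrable_mul_sq {P : ℝ → ℝ} (hP_cont : Continuous P)
    (hP_lim : Tendsto P (cocompact ℝ) (𝓝 0)) (hP_nonneg : ∀ x, 0 ≤ P x) (u : HHalf) :
    Integrable (fun x => P x * (u x) ^ 2) := by
  obtain ⟨K, -, hK⟩ := exists_forall_le_of_tendsto_cocompact hP_cont hP_lim
  exact u.integrable_sq.bdd_mul hP_cont.aestronglyMeasurable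
    (.of_forall fun x => by rw [Real.norm_of_nonneg (hP_nonneg x)]; exact hK x)

theorem WeaklyNull.tendsto_integral_mul_sq {u : ℕ → HHalf} (hu : WeaklyNull u) {P : ℝ → ℝ}
    (hP_cont : Continuous P) (hP_nonneg : ∀ x, 0 ≤ P x)
    (hP_lim : Tendsto P (cocompact ℝ) (𝓝 0)) :
    Tendsto (fun n => ∫ x, P x * (u n x) ^ 2) atTop (𝓝 0) := by
  obtain ⟨B, hB0, hB⟩ := hu.exists_norm_le
  obtain ⟨K, hK0, hK⟩ := exists_forall_le_of_tendsto_cocompact hP_cont hP_lim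
  refine Metric.tendsto_nhds.2 fun ε hε => ?_
  -- Where P < η the integral is at most η B² ≤ ε/2; the remaining points lie in a bounded interval,
  -- where P ≤ K.
  set η := ε / (2 * (B ^ 2 + 1))
  have hη : 0 < η := by positivity
  have hηB : η * B ^ 2 ≤ ε / 2 := by
    have : η * (2 * (B ^ 2 + 1)) = ε := div_mul_cancel₀ _ (by positivity)
    nlinarith
  obtain ⟨S, hS, hSP⟩ := mem_cocompact.1 (hP_lim.eventually (gt_mem_nhds hη))
  obtain ⟨R, hR⟩ := hS.isBounded.subset_closedBall 0
  rw [Real.closedBall_eq_Icc, zero_sub, zero_add] at hR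
  filter_upwards [(hu.tendsto_setIntegral_sq R).eventually
    (gt_mem_nhds (show (0 : ℝ) < ε / (2 * (K + 1)) by positivity))] with n hn
  have h0 : 0 ≤ ∫ x, P x * (u n x) ^ 2 :=
    integral_nonneg fun x => mul_nonneg (hP_nonneg x) (sq_nonneg _)
  rw [Real.dist_eq, sub_zero, abs_of_nonneg h0]
  have hi := (u n).integrable_sq
  have hi' := hi.indicator (measurableSet_Icc (a := -R) (b := R))
  have hle : ∫ x, P x * (u n x) ^ 2 ≤
      ∫ x, (η * (u n x) ^ 2 + K * (Set.Icc (-R) R).indicator (fun x => (u n x) ^ 2) x) := by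
    refine integral_mono (integrable_mul_sq hP_cont hP_lim hP_nonneg _)
      ((hi.const_mul η).add (hi'.const_mul K)) fun x => ?_
    have hsq := sq_nonneg (u n x)
    by_cases hx : x ∈ Set.Icc (-R) R
    · simp only [Set.indicator_of_mem hx]
      nlinarith [hK x, mul_nonneg hη.le hsq, mul_le_mul_of_nonneg_right (hK x) hsq]
    · simp only [Set.indicator_of_notMem hx, mul_zero, add_zero]
      have h1 : P x < η := hSP fun hxS => hx (hR hxS)
      gcongr
  rw [integral_add (hi.const_mul η) (hi'.const_mul K), integral_const_mul, integral_const_mul,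
    integral_indicator measurableSet_Icc] at hle
  have h1 : η * ∫ x, (u n x) ^ 2 ≤ η * B ^ 2 := by
    gcongr
    exact (u n).integral_sq_le.trans (by gcongr; exact hB n)
  have h2 : K * ∫ x in Set.Icc (-R) R, (u n x) ^ 2 < ε / 2 := by
    rw [lt_div_iff₀ (by positivity)] at hn
    have h3 : 0 ≤ ∫ x in Set.Icc (-R) R, (u n x) ^ 2 := integral_nonneg fun x => sq_nonneg _
    nlinarith
  linarith

theorem weightedIntegralsVanish_of_isDominated {P f h : ℝ → ℝ}
    (hP_cont : Continuous P) (hP_nonneg : ∀ x, 0 ≤ P x)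
    (hP_lim : Tendsto P (cocompact ℝ) (𝓝 0))
    (hh_cont : Continuous h) (hh_nonneg : ∀ t, 0 ≤ h t) (hdom : IsDominated f h)
    {u : ℕ → HHalf} (hu : WeaklyNull u) (hE : BoundedEnergy P f u) :
    WeightedIntegralsVanish P h u := by
  obtain ⟨hint, C, hC0, hC⟩ := hE
  have hsq : ∀ n, Integrable (fun x => P x * (u n x) ^ 2) := fun n =>
    integrable_mul_sq hP_cont hP_lim hP_nonneg (u n)
  have hnn : ∀ n x, 0 ≤ P x * h (u n x) := fun n x => mul_nonneg (hP_nonneg x) (hh_nonneg _)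
  have hle : ∀ {ε D : ℝ}, (∀ t, h t ≤ ε * (t * f t) + D * t ^ 2) → ∀ n x, P x * h (u n x) ≤
      ε * (P x * f (u n x) * u n x) + D * (P x * (u n x) ^ 2) := fun hD n x =>
    (mul_le_mul_of_nonneg_left (hD (u n x)) (hP_nonneg x)).trans_eq (by ring)
  have hhint : ∀ n, Integrable (fun x => P x * h (u n x)) := fun n => by
    obtain ⟨D, -, hD⟩ := hdom 1 one_pos
    refine (((hint n).const_mul 1).add ((hsq n).const_mul D)).mono'
      (hP_cont.aestronglyMeasurable.mul
        (hh_cont.comp_aestronglyMeasurable (Lp.memLp (HHalf.toL2 (u n))).1))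
      (.of_forall fun x => ?_)
    rw [Real.norm_of_nonneg (hnn n x)]
    exact hle hD n x
  refine ⟨hhint, Metric.tendsto_nhds.2 fun ε hε => ?_⟩
  -- With this factor the energy term contributes at most ε/2, as the energy is below C.
  obtain ⟨D, hD0, hD⟩ := hdom (ε / (2 * C)) (by positivity)
  filter_upwards [(hu.tendsto_integral_mul_sq hP_cont hP_nonneg hP_lim).eventually
    (gt_mem_nhds (show (0 : ℝ) < ε / (2 * (D + 1)) by positivity))] with n hn
  rw [Real.dist_eq, sub_zero, abs_of_nonneg (integral_nonneg (hnn n))]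
  have h1 := integral_mono (hhint n) (((hint n).const_mul (ε / (2 * C))).add
    ((hsq n).const_mul D)) (hle hD n)
  rw [integral_add' ((hint n).const_mul _) ((hsq n).const_mul D), integral_const_mul,
    integral_const_mul] at h1
  have h2 : ε / (2 * C) * ∫ x, P x * f (u n x) * u n x ≤ ε / 2 := by
    calc ε / (2 * C) * ∫ x, P x * f (u n x) * u n x ≤ ε / (2 * C) * C := by
          gcongr; exact (hC n).le
      _ = ε / 2 := by field_simp
  have h3 : D * ∫ x, P x * (u n x) ^ 2 < ε / 2 := by
    rw [lt_div_iff₀ (by positivity)] at hn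
    have h4 : 0 ≤ ∫ x, P x * (u n x) ^ 2 :=
      integral_nonneg fun x => mul_nonneg (hP_nonneg x) (sq_nonneg _)
    nlinarith
  linarith

theorem mainTheorem6 (P f : ℝ → ℝ)
    (hP_cont : Continuous P) (hP_nonneg : ∀ x, 0 ≤ P x)
    (hP_lim : Tendsto P (cocompact ℝ) (𝓝 0))
    (hf_cont : Continuous f) (hf_nonneg : ∀ t, 0 ≤ f t) (hf_neg : ∀ t ≤ 0, f t = 0)
    (H2 : f =o[𝓝 0] (fun t : ℝ => t))
    (H5 : Tendsto (fun t => primitive f t / (t * f t)) atTop (𝓝 0)) :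
    ClassC P f ∧
      (f =O[𝓝 0] (fun t : ℝ => t ^ 2) →
        ∀ u : ℕ → HHalf, WeaklyNull u → BoundedEnergy P f u →
          WeightedIntegralsVanish P f u) :=
  ⟨fun _ hu hE => weightedIntegralsVanish_of_isDominated hP_cont hP_nonneg hP_lim
      (continuous_primitive hf_cont) (primitive_nonneg hf_nonneg hf_neg)
      (isDominated_primitive hf_cont hf_nonneg hf_neg H2 H5) hu hE,
    fun h0 _ hu hE => weightedIntegralsVanish_of_isDominated hP_cont hP_nonneg hP_lim
      hf_cont hf_nonneg (isDominated_self hf_cont hf_nonneg hf_neg h0) hu hE⟩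

end
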